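/- Let $AP$ be a finite set of atomic propositions and let $\mathfrak T=(V,E,V_I,\lambda)$ be a finite transition system: $V$ is a finite set of vertices, $E\subseteq V\times V$ is such that every vertex has at least one successor, $\emptyset\neq V_I\subseteq V$, and $\lambda\colon V\to 2^{AP}$. Write $\mathrm{Succ}(v)$ for the set of successors of $v$. For nonempty $V'\subseteq V$ let $\mathrm{Tr}(\mathfrak T_{V'})\subseteq(2^{AP})^\omega$ be the set of traces $\lambda(\rho(0))\lambda(\rho(1))\cdots$ of infinite paths $\rho$ with $\rho(0)\in V'$, and let $\mathfrak T_v=\mathfrak T_{\{v\}}$. For infinite words $w_0,\dots,w_{n-1}$ over $\Sigma$ let $\mathrm{mrg}(w_0,\dots,w_{n-1})$ be the word over $\Sigma^n$ whose $r$-th letter is $(w_0(r),\dots,w_{n-1}(r))$. Let $k$ be even, $I_\forall=\{0,2,\dots,k-2\}$ and $I_\exists=\{1,3,\dots,k-1\}$. For each $j\in I_\exists$ let $\mathcal A_j$ be a deterministic one-pair Rabin automaton over the alphabet $(2^{AP})^{j+1}$, with finite state set and acceptance pair $(B,F)$: a run is accepting if it visits $B$ only finitely often and $F$ infinitely often. $\mathcal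 A_j[q]$ denotes $\mathcal A_j$ with initial state $q$. For a run $\kappa$, let $\mathrm{lastB}(\kappa)$ be $\bot$ if $\kappa$ never visits $B$, $\infty$ if it visits $B$ infinitely often, and otherwise the position of its last visit to $B$. Let $\mathrm{firstF}(\kappa)$ be the position of the first visit to $F$, and $\infty$ if there is none. The progress value $\mathrm{val}(\kappa)\in\mathbb N\cup\{\infty\}$ is $\mathrm{firstF}(\kappa)$ if $\mathrm{lastB}(\kappa)=\bot$, and $\max\{\mathrm{lastB}(\kappa),\mathrm{firstF}(\kappa)\}$ otherwise. For $j\in I_\exists$, a state $q$ of $\mathcal A_j$, $v\in V$ and traces $t_0,\dots,t_{j-1}$, let $$\mathrm{opt}_j(q,v,t_0,\dots,t_{j-1})=\min_{t\in \mathrm{Tr}(\mathfrak T_{\mathrm{Succ}(v)})}\mathrm{val}(\kappa^{t}),$$ where $\kappa^{t}$ is the run of $\mathcal A_j[q]$ on $\mathrm{mrg}(t_0,\dots,t_{j-1},t)$. Let $i\in I_\forall$, let $\bar q=(q_1,q_3,\dots,q_{i+1})$ with $q_j$ a state of $\mathcal A_j$, and let $\bar u=(v_0,\dots,v_{i+1})$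 and $\bar v=(v'_0,\dots,v'_{i+1})$ be vectors of vertices with $v'_\ell\in\mathrm{Succ}(v_\ell)$ for all $\ell\le i+1$. The progress prophecy $P_i^{\bar q}(\bar u,\bar v)$ is the set of all words $\mathrm{mrg}(t_0,t_2,\dots,t_i)$ with $t_\ell\in\mathrm{Tr}(\mathfrak T_{v'_\ell})$ for all even $\ell\le i$ such that there exist $t_\ell\in\mathrm{Tr}(\mathfrak T_{v'_\ell})$ for all odd $\ell\le i+1$ with the following property: for every odd $j\le i+1$, the run $\kappa_j$ of $\mathcal A_j[q_j]$ on $\mathrm{mrg}(t_0,\dots,t_j)$ is accepting and satisfies $\mathrm{val}(\kappa_j)=\mathrm{opt}_j(q_j,v_j,t_0,\dots,t_{j-1})$. **Lemma.** For all such $i,\bar q,\bar u,\bar v$, the language $P_i^{\bar q}(\bar u,\bar v)$ is $\omega$-regular, i.e., it is recognized by a nondeterministic Büchi automaton with finitely many states. -/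

import Mathlib

/-! ### Infinite words and omega-regular languages -/

/-- The merge (zip) of a family of infinite words: an infinite word over the product alphabet. -/
def merge {ι α : Type*} (w : ι → ℕ → α) : ℕ → ι → α := fun n j => w j n

/-- Nondeterministic Büchi automata over the alphabet `α` with state set `Q`. -/
structure BuchiAutomaton (α Q : Type*) where
  /-- the initial state -/
  start : Q
  /-- the transition relation: `step q a` is the set of `a`-successors of `q` -/
  step : Q → α → Set Q
  /-- the accepting states -/
  accepting : Set Q

/-- The language of a Büchi automaton: the infinite words that have a run visiting
accepting states infinitely often. -/
def BuchiAutomaton.language {α Q : Type*} (M : BuchiAutomaton α Q) : Set (ℕ → α) :=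
  {w | ∃ ρ : ℕ → Q, ρ 0 = M.start ∧ (∀ n, ρ (n + 1) ∈ M.step (ρ n) (w n)) ∧
    {n | ρ n ∈ M.accepting}.Infinite}

/-- A set of infinite words is omega-regular if it is the language of a nondeterministic
Büchi automaton with finitely many states. -/
def IsOmegaRegular {α : Type*} (L : Set (ℕ → α)) : Prop :=
  ∃ (Q : Type) (_ : Finite Q) (M : BuchiAutomaton α Q), M.language = L

/-! ### Transition systems -/

/-- A trace over `AP` is an infinite word over the alphabet of subsets of `AP`. -/
abbrev Trace (AP : Type*) := ℕ → Set AP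

/-- Transition systems with vertex set `V`, labelled by sets of atomic propositions. -/
structure TransitionSystem (V AP : Type*) where
  /-- the edge relation -/
  edge : V → V → Prop
  /-- the initial vertices -/
  init : Set V
  /-- the labelling of the vertices -/
  label : V → Set AP
  init_nonempty : init.Nonempty
  exists_edge : ∀ v, ∃ v', edge v v'

namespace TransitionSystem

variable {V AP : Type*}

/-- The set of successors of a vertex. -/
def succ (T : TransitionSystem V AP) (v : V) : Set V := {v' | T.edge v v'}

theorem succ_nonempty (T : TransitionSystem V AP) (v : V) : (T.succ v).Nonempty :=
  T.exists_edge v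

/-- Paths: infinite sequences of vertices along edges, starting in an initial vertex. -/
def IsPath (T : TransitionSystem V AP) (ρ : ℕ → V) : Prop :=
  ρ 0 ∈ T.init ∧ ∀ n, T.edge (ρ n) (ρ (n + 1))

/-- The set of traces of all paths of `T`. -/
def traces (T : TransitionSystem V AP) : Set (Trace AP) :=
  {t | ∃ ρ, T.IsPath ρ ∧ t = fun n => T.label (ρ n)}

/-- The system obtained from `T` by making `V'` the set of initial vertices. -/
def withInit (T : TransitionSystem V AP) (V' : Set V) (h : V'.Nonempty) :
    TransitionSystem V AP where
  edge := T.edge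
  init := V'
  label := T.label
  init_nonempty := h
  exists_edge := T.exists_edge

/-- The system `T` with the single initial vertex `v`. -/
def startAt (T : TransitionSystem V AP) (v : V) : TransitionSystem V AP :=
  T.withInit {v} (Set.singleton_nonempty v)

/-- The system `T` with the successors of `v` as initial vertices. -/
def startAtSucc (T : TransitionSystem V AP) (v : V) : TransitionSystem V AP :=
  T.withInit (T.succ v) (T.succ_nonempty v)

end TransitionSystem

/-! ### One-pair Rabin automata and the value of a run -/

/-- Deterministic Rabin automata with a single acceptance pair `(B, F)`. -/
structure OnePairRabin (α Q : Type*) where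
  /-- the initial state -/
  start : Q
  /-- the transition function -/
  step : Q → α → Q
  /-- the states that may be visited only finitely often -/
  B : Set Q
  /-- the states that must be visited infinitely often -/
  F : Set Q

namespace OnePairRabin

variable {α Q : Type*}

/-- The automaton with its initial state replaced by `q`. -/
def withStart (A : OnePairRabin α Q) (q : Q) : OnePairRabin α Q where
  start := q
  step := A.step
  B := A.B
  F := A.F

/-- The run of the automaton on an infinite word. -/
def run (A : OnePairRabin α Q) (w : ℕ → α) : ℕ → Q
  | 0 => A.start
  | n + 1 => A.step (A.run w n) (w n)

/-- A state sequence is accepting if it visits `B` only finitely often and `F` infinitely often. -/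
def IsAccepting (A : OnePairRabin α Q) (κ : ℕ → Q) : Prop :=
  {n | κ n ∈ A.B}.Finite ∧ {n | κ n ∈ A.F}.Infinite

open Classical in
/-- The position of the last visit of `κ` in `B`: `⊥` if there is no visit at all, and `∞` (`⊤`)
if there are infinitely many visits. -/
noncomputable def lastB (A : OnePairRabin α Q) (κ : ℕ → Q) : WithBot ℕ∞ :=
  if ∀ n, κ n ∉ A.B then ⊥
  else if {n | κ n ∈ A.B}.Infinite then ((⊤ : ℕ∞) : WithBot ℕ∞)
  else (((sSup {n : ℕ | κ n ∈ A.B} : ℕ) : ℕ∞) : WithBot ℕ∞)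

open Classical in
/-- The position of the first visit of `κ` in `F`, and `∞` if there is no such visit. -/
noncomputable def firstF (A : OnePairRabin α Q) (κ : ℕ → Q) : ℕ∞ :=
  if ∃ n, κ n ∈ A.F then ((sInf {n : ℕ | κ n ∈ A.F} : ℕ) : ℕ∞) else ⊤

/-- The value of a run: `firstF κ` if `lastB κ = ⊥`, and `max (lastB κ) (firstF κ)` otherwise. -/
noncomputable def val (A : OnePairRabin α Q) (κ : ℕ → Q) : ℕ∞ :=
  match A.lastB κ with
  | ⊥ => A.firstF κ
  | (b : ℕ∞) => max b (A.firstF κ)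

end OnePairRabin

/-- For fixed traces `t₀, …, tⱼ₋₁`, the smallest value of a run of `A[q]` on the merge of
`t₀, …, tⱼ₋₁, t'`, where `t'` ranges over the traces that start in a successor of `v`.
There is always such a `t'`, and every nonempty set in `ℕ∞` has a least element,
so this infimum is a minimum. -/
noncomputable def opt {V AP Q : Type*} (T : TransitionSystem V AP) {j : ℕ}
    (A : OnePairRabin (Fin (j + 1) → Set AP) Q) (q : Q) (v : V) (t : Fin j → Trace AP) : ℕ∞ :=
  ⨅ t' ∈ (T.startAtSucc v).traces,
    A.val ((A.withStart q).run (merge (Fin.snoc (α := fun _ => Trace AP) t t')))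

/-! ### Progress prophecies -/

/-- The indices `0, 2, 4, …` below `k` (those of the universally quantified trace variables). -/
abbrev IForall (k : ℕ) := {j : Fin k // Even (j : ℕ)}

/-- The indices `1, 3, 5, …` below `k` (those of the existentially quantified trace variables). -/
abbrev IExists (k : ℕ) := {j : Fin k // Odd (j : ℕ)}

theorem IForall.add_two_le {k : ℕ} (hk : Even k) (i : IForall k) : (i.1 : ℕ) + 2 ≤ k := by
  obtain ⟨⟨i, hik⟩, hi⟩ := i
  obtain ⟨a, rfl⟩ := hk
  obtain ⟨b, hb⟩ := hi
  simp only at hb ⊢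
  omega

/-- Regard an odd index below `m` as an odd index below `k`, for `m ≤ k`. -/
def IExists.castLE {m k : ℕ} (h : m ≤ k) (j : IExists m) : IExists k :=
  ⟨Fin.castLE h j.1, j.2⟩

/-- The progress prophecy for `i`, the states `q = (q₁, q₃, …, qᵢ₊₁)` and the vertices
`u = (v₀, …, vᵢ₊₁)` and `v = (v'₀, …, v'ᵢ₊₁)`. Here `IForall (i + 2)` consists of the even numbers
`0, 2, …, i` and `IExists (i + 2)` of the odd numbers `1, 3, …, i + 1`. The family `s` consists of
the traces with even index, and `t = (t₀, …, tᵢ₊₁)` extends it by the witness traces with odd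
index. -/
def progressProphecy {V AP : Type*} (T : TransitionSystem V AP) {k : ℕ} (hk : Even k)
    {Q : IExists k → Type*} (A : ∀ j : IExists k, OnePairRabin (Fin (j.1 + 1) → Set AP) (Q j))
    (i : IForall k)
    (q : ∀ j : IExists (i.1 + 2), Q (j.castLE (i.add_two_le hk)))
    (u v : Fin (i.1 + 2) → V) : Set (ℕ → IForall (i.1 + 2) → Set AP) :=
  {w | ∃ s : IForall (i.1 + 2) → Trace AP,
    w = merge s ∧
    (∀ j, s j ∈ (T.startAt (v j.1)).traces) ∧
    ∃ t : Fin (i.1 + 2) → Trace AP,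
      (∀ j : IForall (i.1 + 2), t j.1 = s j) ∧
      (∀ j : IExists (i.1 + 2), t j.1 ∈ (T.startAt (v j.1)).traces) ∧
      ∀ j : IExists (i.1 + 2),
        let Aj := A (j.castLE (i.add_two_le hk))
        let κ := (Aj.withStart (q j)).run
          (merge fun l : Fin (j.1 + 1) => t (Fin.castLE j.1.isLt l))
        Aj.IsAccepting κ ∧
        Aj.val κ = opt T Aj (q j) (u j.1) (fun l : Fin j.1 => t (Fin.castLE j.1.isLt.le l))}

/-!
A run has value less than `n` iff at every position from `n` on, `F` has been visited before and the
current state is not in `B`. Once the positions before `n` are marked in the input, this is a safety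
condition, and so is the optimal value being less than `n`, for an automaton that also guesses the
trace over which the minimum is taken. By König's lemma the failure of a nondeterministic safety
condition shows after finitely many letters, so it is recognized by the subset construction. Hence
the value, or the optimal value, being equal to `n` is recognized by an automaton that does not
depend on `n`. The value of an accepting run is finite, so guessing the marking yields the words on
which the two values agree. The prophecy is a projection of the intersection of these languages with
the conditions that the tracks of the word are traces.
-/

open Filter

/-! ### Closure properties of omega-regular languages -/

theorem BuchiAutomaton.isOmegaRegular_language {α Q : Type*} [Finite Q]
    (M : BuchiAutomaton α Q) : IsOmegaRegular M.language := by
  obtain ⟨n, ⟨e⟩⟩ := Finite.exists_equiv_fin Q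
  refine ⟨Fin n, inferInstance,
    ⟨e M.start, fun q a => e.symm ⁻¹' M.step (e.symm q) a, e.symm ⁻¹' M.accepting⟩, ?_⟩
  ext w
  constructor
  · rintro ⟨ρ, hstart, hstep, hacc⟩
    exact ⟨e.symm ∘ ρ, by simp [hstart], hstep, hacc⟩
  · rintro ⟨ρ, hstart, hstep, hacc⟩
    exact ⟨e ∘ ρ, by simp [hstart], by simpa using hstep, by simpa using hacc⟩

/-- The indices seen since the last reset, where `p n` is the set of indices present at time `n`
and a reset happens as soon as all indices have been seen. A product of Büchi automata keeps this
set in its state to turn finitely many recurrence conditions into a single one. -/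
noncomputable def seenSinceReset {ι : Type*} (p : ℕ → Set ι) : ℕ → Set ι
  | 0 => ∅
  | n + 1 => open Classical in
    if seenSinceReset p n = Set.univ then ∅ else seenSinceReset p n ∪ p n

section SeenSinceReset

variable {ι : Type*} {p : ℕ → Set ι}

theorem eventually_seenSinceReset_ne_univ {i : ι} (h : ∀ᶠ n in atTop, i ∉ p n) :
    ∀ᶠ n in atTop, seenSinceReset p n ≠ Set.univ := by
  obtain ⟨a, ha⟩ := eventually_atTop.1 h
  by_contra hfreq
  obtain ⟨b, hab, hb⟩ := frequently_atTop.1 (not_eventually.1 hfreq) a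
  have not_seen : ∀ n ≥ b + 1, i ∉ seenSinceReset p n := fun n hn => by
    induction n, hn using Nat.le_induction with
    | base => simp [seenSinceReset, not_not.1 hb]
    | succ n hn ih =>
      rw [seenSinceReset]
      split_ifs
      · exact Set.notMem_empty i
      · exact fun hi => hi.elim ih (ha n (by omega))
  refine hfreq (eventually_atTop.2 ⟨b + 1, fun n hn huniv => not_seen n hn ?_⟩)
  exact huniv ▸ Set.mem_univ i

theorem frequently_seenSinceReset_eq_univ [Finite ι] (h : ∀ i, ∃ᶠ n in atTop, i ∈ p n) :
    ∃ᶠ n in atTop, seenSinceReset p n = Set.univ := by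
  intro hne
  obtain ⟨a, ha⟩ := eventually_atTop.1 hne
  have seen_succ : ∀ n ≥ a, seenSinceReset p (n + 1) = seenSinceReset p n ∪ p n := fun n hn => by
    rw [seenSinceReset, if_neg (ha n hn)]
  have eventually_seen : ∀ i, ∀ᶠ n in atTop, i ∈ seenSinceReset p n := fun i => by
    obtain ⟨b, hab, hb⟩ := frequently_atTop.1 (h i) a
    refine eventually_atTop.2 ⟨b + 1, fun n hn => ?_⟩
    induction n, hn using Nat.le_induction with
    | base => exact seen_succ b hab ▸ Or.inr hb
    | succ n hn ih => exact seen_succ n (by omega) ▸ Or.inl ih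
  obtain ⟨n, hn, hseen⟩ := (hne.and (eventually_all.2 eventually_seen)).exists
  exact hn (Set.eq_univ_of_forall hseen)

theorem infinite_seenSinceReset_eq_univ_iff [Finite ι] :
    {n | seenSinceReset p n = Set.univ}.Infinite ↔ ∀ i, {n | i ∈ p n}.Infinite := by
  simp only [← Nat.frequently_atTop_iff_infinite]
  exact ⟨fun h i hi => h (eventually_seenSinceReset_ne_univ hi), frequently_seenSinceReset_eq_univ⟩

end SeenSinceReset

namespace IsOmegaRegular

variable {α β : Type*}

theorem preimage {L : Set (ℕ → β)} (hL : IsOmegaRegular L) (f : α → β) :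
    IsOmegaRegular {w : ℕ → α | f ∘ w ∈ L} := by
  obtain ⟨Q, _, M, rfl⟩ := hL
  exact ⟨Q, inferInstance, ⟨M.start, fun q a => M.step q (f a), M.accepting⟩, rfl⟩

theorem image {L : Set (ℕ → α)} (hL : IsOmegaRegular L) (f : α → β) :
    IsOmegaRegular ((f ∘ ·) '' L) := by
  obtain ⟨Q, _, M, rfl⟩ := hL
  refine ⟨Q, inferInstance,
    ⟨M.start, fun q b => {q' | ∃ a, f a = b ∧ q' ∈ M.step q a}, M.accepting⟩, ?_⟩
  ext w
  constructor
  · rintro ⟨ρ, hstart, hstep, hacc⟩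
    choose w' hw' hstep' using hstep
    exact ⟨w', ⟨ρ, hstart, hstep', hacc⟩, funext hw'⟩
  · rintro ⟨w', ⟨ρ, hstart, hstep, hacc⟩, rfl⟩
    exact ⟨ρ, hstart, fun n => ⟨w' n, rfl, hstep n⟩, hacc⟩

open Classical in
theorem iInter {ι : Type*} [Finite ι] {L : ι → Set (ℕ → α)} (hL : ∀ i, IsOmegaRegular (L i)) :
    IsOmegaRegular (⋂ i, L i) := by
  choose Q hQ M hM using hL
  let N : BuchiAutomaton α ((∀ i, Q i) × Set ι) :=
    { start := (fun i => (M i).start, ∅)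
      step := fun x a => {y | (∀ i, y.1 i ∈ (M i).step (x.1 i) a) ∧
        y.2 = if x.2 = Set.univ then ∅ else x.2 ∪ {i | x.1 i ∈ (M i).accepting}}
      accepting := {x | x.2 = Set.univ} }
  suffices h : N.language = ⋂ i, L i from h ▸ N.isOmegaRegular_language
  ext w
  simp only [Set.mem_iInter, ← hM]
  constructor
  · rintro ⟨ρ, hstart, hstep, hacc⟩
    let p : ℕ → Set ι := fun n => {i | (ρ n).1 i ∈ (M i).accepting}
    have seen_eq : ∀ n, (ρ n).2 = seenSinceReset p n := fun n => by
      induction n with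
      | zero => rw [hstart]; rfl
      | succ n ih => rw [(hstep n).2, ih]; rfl
    have hacc' : ∀ i, {n | i ∈ p n}.Infinite :=
      infinite_seenSinceReset_eq_univ_iff.1 (by simp only [← seen_eq]; exact hacc)
    exact fun i => ⟨fun n => (ρ n).1 i, by simp [hstart, N], fun n => (hstep n).1 i, hacc' i⟩
  · intro h
    choose ρ hstart hstep hacc using h
    exact ⟨fun n => (fun i => ρ i n, seenSinceReset (fun n => {i | ρ i n ∈ (M i).accepting}) n),
      by simp [hstart, N, seenSinceReset], fun n => ⟨fun i => hstep i n, rfl⟩,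
      infinite_seenSinceReset_eq_univ_iff.2 hacc⟩

theorem inter {L₁ L₂ : Set (ℕ → α)} (h₁ : IsOmegaRegular L₁) (h₂ : IsOmegaRegular L₂) :
    IsOmegaRegular (L₁ ∩ L₂) := by
  rw [Set.inter_eq_iInter]
  exact iInter (Bool.forall_bool.2 ⟨h₂, h₁⟩)

end IsOmegaRegular

/-! ### Finite automata on infinite words -/

/-- A run of a nondeterministic automaton on an infinite word. The accepting states play no role
here: below they serve as a Büchi condition or as the states in which a run has to remain from
some position on. -/
def IsInfiniteRun {α P : Type*} (M : NFA α P) (w : ℕ → α) (r : ℕ → P) : Prop :=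
  r 0 ∈ M.start ∧ ∀ m, r (m + 1) ∈ M.step (r m) (w m)

/-- The first `n` transitions of `r` form a run of `M` on the prefix of `w` of length `n`; the
states of `r` after position `n` are arbitrary. -/
def IsRunUpTo {α P : Type*} (M : NFA α P) (w : ℕ → α) (n : ℕ) (r : ℕ → P) : Prop :=
  r 0 ∈ M.start ∧ ∀ m < n, r (m + 1) ∈ M.step (r m) (w m)

/-- The finite word formed by the first `n` letters of an infinite word. -/
def wordPrefix {α : Type*} (w : ℕ → α) (n : ℕ) : List α := (List.range n).map w

section InfiniteRuns

variable {α P : Type*}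

theorem wordPrefix_succ (w : ℕ → α) (n : ℕ) : wordPrefix w (n + 1) = wordPrefix w n ++ [w n] := by
  simp [wordPrefix, List.range_succ]

/-- The additional initial state of the Büchi automaton stands for all initial states of `M`. -/
theorem isOmegaRegular_setOf_exists_run_infinite_accept [Finite P] (M : NFA α P) :
    IsOmegaRegular {w | ∃ r, IsInfiniteRun M w r ∧ {n | r n ∈ M.accept}.Infinite} := by
  let N : BuchiAutomaton α (Option P) :=
    { start := none
      step := fun p a => some '' M.stepSet (p.elim M.start singleton) a
      accepting := some '' M.accept }
  suffices h : N.language = {w | ∃ r, IsInfiniteRun M w r ∧ {n | r n ∈ M.accept}.Infinite} from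
    h ▸ N.isOmegaRegular_language
  ext w
  simp only [BuchiAutomaton.language, ← Nat.frequently_atTop_iff_infinite]
  have accepting_congr : ∀ {ρ : ℕ → Option P} {r : ℕ → P}, (∀ n, ρ (n + 1) = some (r (n + 1))) →
      ((∃ᶠ n in atTop, ρ n ∈ N.accepting) ↔ ∃ᶠ n in atTop, r n ∈ M.accept) := fun {ρ r} h =>
    frequently_congr <| (eventually_ge_atTop 1).mono fun n hn => by
      obtain ⟨m, rfl⟩ := Nat.exists_eq_add_of_le' hn
      simp [N, h]
  constructor
  · rintro ⟨ρ, hstart, hstep, hacc⟩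
    choose r hr hρ using hstep
    obtain ⟨p, hp, hrp⟩ := NFA.mem_stepSet.1 (hr 0)
    have hp : p ∈ M.start := by simpa [hstart, N] using hp
    have hr_succ : ∀ n, r (n + 1) ∈ M.step (r n) (w (n + 1)) := fun n => by
      simpa [← hρ n] using hr (n + 1)
    exact ⟨fun n => n.casesOn p r, ⟨hp, fun n => n.casesOn hrp hr_succ⟩,
      (accepting_congr fun n => (hρ n).symm).1 hacc⟩
  · rintro ⟨r, ⟨hstart, hstep⟩, hacc⟩
    refine ⟨fun n => n.casesOn none fun n => some (r (n + 1)), rfl, fun n => ?_,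
      (accepting_congr fun n => rfl).2 hacc⟩
    refine ⟨r (n + 1), NFA.mem_stepSet.2 ⟨r n, ?_, hstep n⟩, rfl⟩
    cases n with
    | zero => exact hstart
    | succ n => exact Set.mem_singleton _

theorem isOmegaRegular_setOf_exists_isInfiniteRun [Finite P] (M : NFA α P) :
    IsOmegaRegular {w | ∃ r, IsInfiniteRun M w r} := by
  simpa [Set.infinite_univ, IsInfiniteRun] using
    isOmegaRegular_setOf_exists_run_infinite_accept { M with accept := Set.univ }

theorem isInfiniteRun_toNFA_iff (D : DFA α P) (w : ℕ → α) (r : ℕ → P) :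
    IsInfiniteRun D.toNFA w r ↔ r = fun n => D.eval (wordPrefix w n) := by
  constructor
  · rintro ⟨hstart, hstep⟩
    ext n
    induction n with
    | zero => exact hstart
    | succ n ih =>
      rw [wordPrefix_succ, DFA.eval_append_singleton, ← ih]
      exact hstep n
  · rintro rfl
    exact ⟨rfl, fun n => by simp [wordPrefix_succ]⟩

theorem isOmegaRegular_setOf_infinite_wordPrefix_mem_accepts [Finite P] (D : DFA α P) :
    IsOmegaRegular {w | {n | wordPrefix w n ∈ D.accepts}.Infinite} := by
  simpa [isInfiniteRun_toNFA_iff, DFA.mem_accepts] using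
    isOmegaRegular_setOf_exists_run_infinite_accept D.toNFA

variable {M : NFA α P} {w : ℕ → α} {r : ℕ → P}

theorem IsInfiniteRun.mem_eval (h : IsInfiniteRun M w r) (n : ℕ) :
    r n ∈ M.eval (wordPrefix w n) := by
  induction n with
  | zero => exact h.1
  | succ n ih =>
    rw [wordPrefix_succ, NFA.eval_append_singleton]
    exact NFA.mem_stepSet.2 ⟨r n, ih, h.2 n⟩

theorem exists_isRunUpTo_of_mem_eval {n : ℕ} {p : P} (hp : p ∈ M.eval (wordPrefix w n)) :
    ∃ r, IsRunUpTo M w n r ∧ r n = p := by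
  induction n generalizing p with
  | zero => exact ⟨fun _ => p, ⟨hp, by simp⟩, rfl⟩
  | succ n ih =>
    rw [wordPrefix_succ, NFA.eval_append_singleton] at hp
    obtain ⟨p', hp', hstep⟩ := NFA.mem_stepSet.1 hp
    obtain ⟨r, ⟨hr0, hr⟩, rfl⟩ := ih hp'
    refine ⟨Function.update r (n + 1) p, ⟨by simpa using hr0, fun m hm => ?_⟩, by simp⟩
    rcases (Nat.lt_succ_iff.1 hm).lt_or_eq with hm | rfl
    · simpa [hm.ne, (hm.trans n.lt_succ_self).ne] using hr m hm
    · simpa using hstep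

/-- König's lemma, as compactness of the space of state sequences. -/
theorem exists_isInfiniteRun_of_forall_exists_isRunUpTo [Finite P]
    (h : ∀ n, ∃ r, IsRunUpTo M w n r) : ∃ r, IsInfiniteRun M w r := by
  let _ : TopologicalSpace P := ⊥
  have : DiscreteTopology P := ⟨rfl⟩
  have isClosed_runs : ∀ n, IsClosed {r | IsRunUpTo M w n r} := fun n => by
    simp only [IsRunUpTo, Set.ofPred_and, Set.ofPred_forall]
    refine ((isClosed_discrete M.start).preimage (continuous_apply 0)).inter <|
      isClosed_iInter fun m => isClosed_iInter fun _ => ?_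
    have hcont : Continuous fun r : ℕ → P => (r m, r (m + 1)) := by fun_prop
    exact (isClosed_discrete {x : P × P | x.2 ∈ M.step x.1 (w m)}).preimage hcont
  obtain ⟨r, hr⟩ := IsCompact.nonempty_iInter_of_sequence_nonempty_isCompact_isClosed
    (fun n => {r | IsRunUpTo M w n r}) (fun n r hr => ⟨hr.1, fun m hm => hr.2 m (by omega)⟩) h
    (isClosed_runs 0).isCompact isClosed_runs
  have hr : ∀ n, IsRunUpTo M w n r := Set.mem_iInter.1 hr
  exact ⟨r, (hr 0).1, fun m => (hr (m + 1)).2 m m.lt_succ_self⟩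

theorem exists_isInfiniteRun_iff [Finite P] :
    (∃ r, IsInfiniteRun M w r) ↔ ∀ n, (M.eval (wordPrefix w n)).Nonempty :=
  ⟨fun ⟨r, hr⟩ n => ⟨r n, hr.mem_eval n⟩, fun h =>
    exists_isInfiniteRun_of_forall_exists_isRunUpTo fun n =>
      (exists_isRunUpTo_of_mem_eval (h n).some_mem).imp fun _ => And.left⟩

theorem eval_wordPrefix_eq_empty_of_le {m n : ℕ} (hmn : m ≤ n)
    (h : M.eval (wordPrefix w m) = ∅) : M.eval (wordPrefix w n) = ∅ := by
  induction n, hmn using Nat.le_induction with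
  | base => exact h
  | succ n _ ih => simp [wordPrefix_succ, ih]

/-- By König's lemma, the subset automaton recognizes the absence of infinite runs by reaching the
empty set. -/
theorem isOmegaRegular_setOf_not_exists_isInfiniteRun [Finite P] (M : NFA α P) :
    IsOmegaRegular {w | ¬ ∃ r, IsInfiniteRun M w r} := by
  convert isOmegaRegular_setOf_infinite_wordPrefix_mem_accepts { M.toDFA with accept := {∅} }
    using 1
  ext w
  change _ ↔ {n | M.eval (wordPrefix w n) = ∅}.Infinite
  simp only [Set.mem_ofPred_eq, exists_isInfiniteRun_iff, not_forall, Set.not_nonempty_iff_eq_empty]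
  refine ⟨fun ⟨n, hn⟩ => ?_, fun h => h.nonempty⟩
  exact (Set.Ici_infinite n).mono fun m hm => eval_wordPrefix_eq_empty_of_le hm hn

end InfiniteRuns

/-! ### Languages indexed by a position -/

/-- The word `w` with an additional track marking the positions before `n`. -/
def markBefore {α : Type*} (w : ℕ → α) (n : ℕ) : ℕ → α × Prop := fun m => (w m, m < n)

/-- A family of languages indexed by a position `n` is uniformly omega-regular if a single Büchi
automaton recognizes `L n` when it is told `n` by the marking of the positions before `n`. Words
whose second track is not such a marking are irrelevant. -/
def IsUniformlyOmegaRegular {α : Type*} (L : ℕ → Set (ℕ → α)) : Prop :=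
  ∃ K : Set (ℕ → α × Prop), IsOmegaRegular K ∧ ∀ n w, w ∈ L n ↔ markBefore w n ∈ K

/-- `M` measures `f` if `f w < n` holds exactly for those `n` for which some run of `M` on `w`
consists of accepting states from position `n` on. -/
def Measures {α P : Type*} (M : NFA α P) (f : (ℕ → α) → ℕ∞) : Prop :=
  ∀ (w : ℕ → α) (n : ℕ), f w < n ↔ ∃ r, IsInfiniteRun M w r ∧ ∀ m ≥ n, r m ∈ M.accept

/-- The automaton `M` reading words with a marked initial segment, with only the transitions that
satisfy `g` left after that segment. -/
def guardAfterMark {α P : Type*} (M : NFA α P) (g : P → P → Prop) : NFA (α × Prop) P where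
  step p x := {p' | p' ∈ M.step p x.1 ∧ (¬ x.2 → g p p')}
  start := M.start
  accept := M.accept

section UniformlyOmegaRegular

variable {α β P : Type*}

theorem isInfiniteRun_guardAfterMark_iff {M : NFA α P} {g : P → P → Prop} {w : ℕ → α} {n : ℕ}
    {r : ℕ → P} : IsInfiniteRun (guardAfterMark M g) (markBefore w n) r ↔
      IsInfiniteRun M w r ∧ ∀ m ≥ n, g (r m) (r (m + 1)) := by
  simp only [IsInfiniteRun, guardAfterMark, markBefore, Set.mem_ofPred_eq, not_lt, forall_and,
    and_assoc, ge_iff_le]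

theorem isOmegaRegular_setOf_exists_eq_lt :
    IsOmegaRegular {c : ℕ → Prop | ∃ n, c = fun m => m < n} := by
  let M : NFA Prop Prop :=
    { step := fun p a => {p' | a = p ∧ (p' → p)}
      start := Set.univ
      accept := {False} }
  convert isOmegaRegular_setOf_exists_run_infinite_accept M using 1
  ext c
  constructor
  · rintro ⟨n, rfl⟩
    refine ⟨fun m => m < n, ⟨trivial, fun m => ⟨rfl, m.lt_succ_self.trans⟩⟩, ?_⟩
    exact (Set.Ici_infinite n).mono fun m hm => eq_false (not_lt.2 hm)
  · rintro ⟨r, ⟨-, hstep⟩, hacc⟩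
    obtain rfl : c = r := funext fun m => (hstep m).1
    have hanti : Antitone c := antitone_nat_of_succ_le fun m => (hstep m).2
    have hex : ∃ m, ¬ c m := hacc.nonempty.imp fun m hm => of_eq_false hm
    classical
    refine ⟨Nat.find hex, funext fun m => propext ⟨fun hm => ?_, fun hm => ?_⟩⟩
    · exact not_le.1 fun hle => Nat.find_spec hex (hanti hle hm)
    · exact not_not.1 (Nat.find_min hex hm)

namespace IsUniformlyOmegaRegular

variable {L L₁ L₂ : ℕ → Set (ℕ → α)}

theorem inter (h₁ : IsUniformlyOmegaRegular L₁) (h₂ : IsUniformlyOmegaRegular L₂) :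
    IsUniformlyOmegaRegular fun n => L₁ n ∩ L₂ n := by
  obtain ⟨K₁, hK₁, hL₁⟩ := h₁
  obtain ⟨K₂, hK₂, hL₂⟩ := h₂
  exact ⟨K₁ ∩ K₂, hK₁.inter hK₂, fun n w => and_congr (hL₁ n w) (hL₂ n w)⟩

theorem preimage {L : ℕ → Set (ℕ → β)} (hL : IsUniformlyOmegaRegular L) (f : α → β) :
    IsUniformlyOmegaRegular fun n => {w | f ∘ w ∈ L n} := by
  obtain ⟨K, hK, hL⟩ := hL
  exact ⟨_, hK.preimage (Prod.map f id), fun n w => hL n (f ∘ w)⟩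

/-- The automaton guesses the marking. -/
theorem iUnion (hL : IsUniformlyOmegaRegular L) : IsOmegaRegular (⋃ n, L n) := by
  obtain ⟨K, hK, hL⟩ := hL
  convert (hK.inter (isOmegaRegular_setOf_exists_eq_lt.preimage Prod.snd)).image Prod.fst using 1
  ext w
  rw [Set.mem_iUnion]
  constructor
  · rintro ⟨n, hw⟩
    exact ⟨markBefore w n, ⟨(hL n w).1 hw, n, rfl⟩, rfl⟩
  · rintro ⟨x, ⟨hx, n, hn⟩, rfl⟩
    have hmark : x = markBefore (Prod.fst ∘ x) n := funext fun m => Prod.ext rfl (congrFun hn m)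
    exact ⟨n, (hL n _).2 (hmark ▸ hx)⟩

end IsUniformlyOmegaRegular

theorem Measures.isUniformlyOmegaRegular [Finite P] {M : NFA α P} {f : (ℕ → α) → ℕ∞}
    (h : Measures M f) : IsUniformlyOmegaRegular fun n => {w | f w = n} := by
  have hlt : IsUniformlyOmegaRegular fun n => {w | f w < (n + 1 : ℕ)} :=
    ⟨_, isOmegaRegular_setOf_exists_isInfiniteRun
      (guardAfterMark M fun _ p' => p' ∈ M.accept), fun n w => by
        simp only [Set.mem_ofPred_eq, isInfiniteRun_guardAfterMark_iff, h w (n + 1)]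
        refine exists_congr fun r => and_congr_right fun _ => ⟨fun hr m hm => hr _ (by omega), ?_⟩
        rintro hr (_ | m) hm
        exacts [absurd hm (by omega), hr m (by omega)]⟩
  have hge : IsUniformlyOmegaRegular fun n => {w | ¬ f w < n} :=
    ⟨_, isOmegaRegular_setOf_not_exists_isInfiniteRun
      (guardAfterMark M fun p _ => p ∈ M.accept), fun n w => by
        simp only [Set.mem_ofPred_eq, isInfiniteRun_guardAfterMark_iff, h w n]⟩
  convert hlt.inter hge using 3 with n
  ext w
  rw [Set.mem_ofPred_eq, Set.mem_inter_iff, Set.mem_ofPred_eq, Set.mem_ofPred_eq, not_lt,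
    Nat.cast_succ, Order.lt_add_one_iff_of_not_isMax (by simp), le_antisymm_iff]

end UniformlyOmegaRegular

/-! ### Values of runs -/

namespace OnePairRabin

variable {α Q : Type*} (A : OnePairRabin α Q)

theorem firstF_lt_iff (κ : ℕ → Q) (n : ℕ) : A.firstF κ < n ↔ ∃ m < n, κ m ∈ A.F := by
  rw [firstF]
  split_ifs with h
  · rw [Nat.cast_lt]
    constructor
    · exact fun hlt => ⟨_, hlt, Nat.sInf_mem (s := {n | κ n ∈ A.F}) h⟩
    · rintro ⟨m, hm, hF⟩
      exact (Nat.sInf_le hF).trans_lt hm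
  · simp only [not_top_lt, false_iff]
    rintro ⟨m, -, hF⟩
    exact h ⟨m, hF⟩

theorem lastB_lt_iff (κ : ℕ → Q) (n : ℕ) :
    A.lastB κ < ((n : ℕ∞) : WithBot ℕ∞) ↔ ∀ m ≥ n, κ m ∉ A.B := by
  rw [lastB]
  split_ifs with hnever hinf
  · simpa using fun m _ => hnever m
  · simp only [WithBot.coe_lt_coe, not_top_lt, false_iff]
    intro h
    obtain ⟨m, hm, hn⟩ := hinf.exists_gt n
    exact h m hn.le hm
  · rw [WithBot.coe_lt_coe, Nat.cast_lt]
    have hbdd := (Set.not_infinite.1 hinf).bddAbove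
    push Not at hnever
    constructor
    · exact fun h m hm hB => (h.trans_le hm).not_ge (le_csSup hbdd hB)
    · intro h
      by_contra! hle
      exact h _ hle (Nat.sSup_mem (s := {n | κ n ∈ A.B}) hnever hbdd)

theorem val_lt_iff (κ : ℕ → Q) (n : ℕ) :
    A.val κ < n ↔ (∃ m < n, κ m ∈ A.F) ∧ ∀ m ≥ n, κ m ∉ A.B := by
  rw [← firstF_lt_iff, ← lastB_lt_iff, val]
  cases A.lastB κ with
  | bot => simp
  | coe b => rw [WithBot.coe_lt_coe, and_comm]; exact max_lt_iff

theorem isAccepting_iff (κ : ℕ → Q) :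
    A.IsAccepting κ ↔ {n | κ n ∈ A.F}.Infinite ∧ A.val κ ≠ ⊤ := by
  rw [IsAccepting, and_comm]
  refine and_congr_right fun hF => ⟨fun hB => ?_, fun hval => ?_⟩
  · obtain ⟨m, hm⟩ := hF.nonempty
    obtain ⟨b, hb⟩ := hB.bddAbove
    have hlt : A.val κ < (max b m + 1 : ℕ) := (A.val_lt_iff κ _).2
      ⟨⟨m, by omega, hm⟩, fun l hl hlB => absurd (hb hlB) (by omega)⟩
    exact hlt.ne_top
  · obtain ⟨n, hn⟩ := ENat.ne_top_iff_exists.1 hval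
    have hB := ((A.val_lt_iff κ (n + 1)).1 (by rw [← hn]; exact_mod_cast n.lt_succ_self)).2
    exact (Set.finite_lt_nat (n + 1)).subset fun m hm => not_le.1 fun hle => hB m hle hm

/-- The automaton `A` with a flag for an earlier visit to `F`. It accepts while the flag is set and
the current state is not in `B`. -/
def progressMonitor : DFA α (Q × Prop) where
  step p a := (A.step p.1 a, p.2 ∨ p.1 ∈ A.F)
  start := (A.start, False)
  accept := {p | p.2 ∧ p.1 ∉ A.B}

theorem progressMonitor_eval (w : ℕ → α) (n : ℕ) :
    A.progressMonitor.eval (wordPrefix w n) = (A.run w n, ∃ m < n, A.run w m ∈ A.F) := by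
  induction n with
  | zero => simp [wordPrefix, progressMonitor, run]
  | succ n ih =>
    rw [wordPrefix_succ, DFA.eval_append_singleton, ih]
    exact Prod.ext rfl (propext Nat.exists_lt_succ_right.symm)

theorem measures_progressMonitor :
    Measures A.progressMonitor.toNFA fun w => A.val (A.run w) := by
  intro w n
  simp only [val_lt_iff, isInfiniteRun_toNFA_iff, exists_eq_left, progressMonitor_eval]
  constructor
  · rintro ⟨⟨l, hl, hF⟩, hB⟩ m hm
    exact ⟨⟨l, hl.trans_le hm, hF⟩, hB m hm⟩
  · exact fun h => ⟨(h n le_rfl).1, fun m hm => (h m hm).2⟩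

variable [Finite Q]

theorem isOmegaRegular_setOf_infinite_run_mem_F :
    IsOmegaRegular {w | {n | A.run w n ∈ A.F}.Infinite} := by
  let D : DFA α Q := { step := A.step, start := A.start, accept := A.F }
  have eval_eq : ∀ w n, D.eval (wordPrefix w n) = A.run w n := fun w n => by
    induction n with
    | zero => rfl
    | succ n ih => rw [wordPrefix_succ, DFA.eval_append_singleton, ih]; rfl
  simpa only [DFA.mem_accepts, eval_eq] using
    isOmegaRegular_setOf_infinite_wordPrefix_mem_accepts D

theorem isOmegaRegular_setOf_isAccepting_and_val_eq {f : (ℕ → α) → ℕ∞}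
    (hf : IsUniformlyOmegaRegular fun n => {w | f w = n}) :
    IsOmegaRegular {w | A.IsAccepting (A.run w) ∧ A.val (A.run w) = f w} := by
  have hval := A.measures_progressMonitor.isUniformlyOmegaRegular
  convert A.isOmegaRegular_setOf_infinite_run_mem_F.inter (hval.inter hf).iUnion using 1
  ext w
  simp only [isAccepting_iff, Set.mem_ofPred_eq, Set.mem_inter_iff, Set.mem_iUnion, and_assoc]
  refine and_congr_right fun _ => ⟨fun ⟨hne, heq⟩ => ?_, fun ⟨n, hn, hfn⟩ => ?_⟩
  · obtain ⟨n, hn⟩ := ENat.ne_top_iff_exists.1 hne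
    exact ⟨n, hn.symm, heq ▸ hn.symm⟩
  · exact ⟨hn ▸ ENat.natCast_ne_top n, hn.trans hfn.symm⟩

end OnePairRabin

/-! ### Traces and optimal values -/

/-- The automaton guessing a path of `T` and running `M` on the word obtained from the input and
the trace of that path by combining them letter by letter with `pair`. -/
def guessTrace {V AP α β P : Type*} (T : TransitionSystem V AP) (M : NFA β P)
    (pair : α → Set AP → β) : NFA α (V × P) where
  step p a := T.succ p.1 ×ˢ M.step p.2 (pair a (T.label p.1))
  start := T.init ×ˢ M.start
  accept := {p | p.2 ∈ M.accept}

section Traces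

variable {V AP α β P Q : Type*}

theorem Measures.guessTrace {M : NFA β P} {f : (ℕ → β) → ℕ∞} (h : Measures M f)
    (T : TransitionSystem V AP) (pair : α → Set AP → β) :
    Measures (guessTrace T M pair) fun w => ⨅ t ∈ T.traces, f fun n => pair (w n) (t n) := by
  intro w n
  simp only [iInf_lt_iff, h _ n, exists_prop]
  constructor
  · rintro ⟨_, ⟨ρ, ⟨hinit, hedge⟩, rfl⟩, r, ⟨hstart, hstep⟩, hacc⟩
    exact ⟨fun m => (ρ m, r m), ⟨⟨hinit, hstart⟩, fun m => ⟨hedge m, hstep m⟩⟩, hacc⟩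
  · rintro ⟨r, ⟨⟨hinit, hstart⟩, hstep⟩, hacc⟩
    exact ⟨_, ⟨fun m => (r m).1, ⟨hinit, fun m => (hstep m).1⟩, rfl⟩,
      fun m => (r m).2, ⟨hstart, fun m => (hstep m).2⟩, hacc⟩

variable [Finite V]

theorem isOmegaRegular_traces (T : TransitionSystem V AP) : IsOmegaRegular T.traces := by
  let M : NFA (Set AP) V :=
    { step := fun v a => {v' | a = T.label v ∧ T.edge v v'}
      start := T.init
      accept := ∅ }
  convert isOmegaRegular_setOf_exists_isInfiniteRun M using 1
  ext t
  refine exists_congr fun ρ => ?_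
  simp only [M, TransitionSystem.IsPath, IsInfiniteRun, Set.mem_ofPred_eq, forall_and, funext_iff,
    and_assoc, and_comm (a := ∀ m, t m = _)]

theorem merge_snoc {j : ℕ} (t : Fin j → Trace AP) (t' : Trace AP) :
    merge (Fin.snoc (α := fun _ => Trace AP) t t') =
      fun n => Fin.snoc (α := fun _ => Set AP) (merge t n) (t' n) := by
  ext n l : 2
  refine Fin.lastCases ?_ (fun l => ?_) l <;> simp [merge]

variable [Finite Q] {j : ℕ} (T : TransitionSystem V AP)
  (A : OnePairRabin (Fin (j + 1) → Set AP) Q) (q : Q) (v : V)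

theorem isUniformlyOmegaRegular_setOf_opt_eq :
    IsUniformlyOmegaRegular fun n => {w | opt T A q v (Function.swap w) = n} := by
  convert ((A.withStart q).measures_progressMonitor.guessTrace (T.startAtSucc v)
    (Fin.snoc (α := fun _ => Set AP))).isUniformlyOmegaRegular using 5 with n w
  simp only [opt, merge_snoc]
  rfl

theorem isOmegaRegular_setOf_isAccepting_and_val_eq_opt :
    IsOmegaRegular {w : ℕ → Fin (j + 1) → Set AP | A.IsAccepting ((A.withStart q).run w) ∧
      A.val ((A.withStart q).run w) = opt T A q v fun l n => w n l.castSucc} :=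
  (A.withStart q).isOmegaRegular_setOf_isAccepting_and_val_eq <|
    (isUniformlyOmegaRegular_setOf_opt_eq T A q v).preimage
      fun (a : Fin (j + 1) → Set AP) l => a l.castSucc

end Traces

theorem mainTheorem4_general {V AP : Type*} [Finite V] (T : TransitionSystem V AP)
    {k : ℕ} (hk : Even k) {Q : IExists k → Type*} [∀ j, Finite (Q j)]
    (A : ∀ j : IExists k, OnePairRabin (Fin (j.1 + 1) → Set AP) (Q j))
    (i : IForall k)
    (q : ∀ j : IExists (i.1 + 2), Q (j.castLE (i.add_two_le hk)))
    (u v : Fin (i.1 + 2) → V) :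
    IsOmegaRegular (progressProphecy T hk A i q u v) := by
  have htraces := IsOmegaRegular.iInter fun l : Fin (i.1 + 2) =>
    (isOmegaRegular_traces (T.startAt (v l))).preimage fun a : Fin (i.1 + 2) → Set AP => a l
  have hopt := IsOmegaRegular.iInter fun j : IExists (i.1 + 2) =>
    (isOmegaRegular_setOf_isAccepting_and_val_eq_opt T (A (j.castLE (i.add_two_le hk))) (q j)
      (u j.1)).preimage fun (a : Fin (i.1 + 2) → Set AP) l => a (Fin.castLE j.1.isLt l)
  convert (htraces.inter hopt).image
    fun (a : Fin (i.1 + 2) → Set AP) (l : IForall (i.1 + 2)) => a l.1 using 1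
  ext w
  simp only [Set.mem_image, Set.mem_inter_iff, Set.mem_iInter]
  constructor
  · rintro ⟨s, rfl, hs, t, hts, ht, hval⟩
    refine ⟨merge t, ⟨fun l => ?_, hval⟩, funext fun n => funext fun l => congrFun (hts l) n⟩
    rcases Nat.even_or_odd l.1 with hl | hl
    · have mem_traces : t l ∈ (T.startAt (v l)).traces := hts ⟨l, hl⟩ ▸ hs ⟨l, hl⟩
      exact mem_traces
    · exact ht ⟨l, hl⟩
  · rintro ⟨x, ⟨ht, hval⟩, rfl⟩
    exact ⟨fun l n => x n l.1, rfl, fun l => ht l.1, Function.swap x, fun _ => rfl,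
      fun l => ht l.1, hval⟩

/-- All progress prophecies are omega-regular languages. -/
theorem mainTheorem4 {V AP : Type*} [Finite V] [Finite AP] (T : TransitionSystem V AP)
    {k : ℕ} (hk : Even k) {Q : IExists k → Type*} [∀ j, Finite (Q j)]
    (A : ∀ j : IExists k, OnePairRabin (Fin (j.1 + 1) → Set AP) (Q j))
    (i : IForall k)
    (q : ∀ j : IExists (i.1 + 2), Q (j.castLE (i.add_two_le hk)))
    (u v : Fin (i.1 + 2) → V) (huv : ∀ l, v l ∈ T.succ (u l)) :
    IsOmegaRegular (progressProphecy T hk A i q u v) :=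
  mainTheorem4_general T hk A i q u v
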